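/- All normed linear spaces are real; no completeness is assumed. Definitions. Let $X,Y$ be normed linear spaces and $C\subset X$ a convex set. A continuous mapping $F\colon C\to Y$ is called d.c. (delta-convex) if there is a continuous function $f\colon C\to\mathbb{R}$ such that $y^*\circ F+f$ is convex on $C$ for every continuous linear functional $y^*\in Y^*$ with $\|y^*\|\le 1$. A norm $|\cdot|$ on $Y$ has modulus of convexity of power type $2$ if there is $a>0$ such that $\delta(\varepsilon)\ge a\varepsilon^2$ for every $\varepsilon\in(0,2]$, where $$\delta(\varepsilon)=\inf\Bigl\{1-\tfrac12|x+y| : x,y\in Y,\ |x|=|y|=1,\ |x-y|\ge\varepsilon\Bigr\}\qquad(\inf\emptyset=+\infty).$$ The space $Y$ admits a renorming with modulus of convexity of power type $2$ if some norm on $Y$ equivalent to the given one has this property. A normed linear space $W$ has property (D) if every continuous quadratic form on $W$ is a difference of two nonnegative continuous quadratic forms on $W$ (a quadratic form on $W$ is a function $w\mapsto b(w,w)$ with $b\colon W\times W\to\mathbb{R}$ bilinear). Statement. Let $X,Y,V,Z$ be normed linear spaces, $C\subset X$ an open convex set, $F\colon C\to Y$ and $G\colon C\to V$ d.c. mappings,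 and $B\colon Y\times V\to Z$ a continuous bilinear mapping. Then the mapping $x\mapsto B\bigl(F(x),G(x)\bigr)$ is d.c. on $C$, provided at least one of the following conditions is satisfied: (a) both $Y$ and $V$ admit renormings with modulus of convexity of power type $2$; (b) $Z$ is finite-dimensional and $Y\times V$ has property (D), where $Y\times V$ carries the norm $\max\{\|y\|,\|v\|\}$. -/

import Mathlib

/-- `f` is a control function for `F` on `C`: it is continuous on `C`, and `y* ∘ F + f` is convex
on `C` for every continuous linear functional `y*` of norm at most one. -/
def IsControlFunctionOn {X Y : Type*} [NormedAddCommGroup X] [NormedSpace ℝ X]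
    [NormedAddCommGroup Y] [NormedSpace ℝ Y] (f : X → ℝ) (F : X → Y) (C : Set X) : Prop :=
  ContinuousOn f C ∧
    ∀ φ : Y →L[ℝ] ℝ, ‖φ‖ ≤ 1 → ConvexOn ℝ C (fun x => φ (F x) + f x)

/-- `F` is a d.c. (delta-convex) mapping on the convex set `C`: it is continuous on `C` and has a
control function there. Only the values of `F` and of the control function on `C` matter. -/
def IsDCOn {X Y : Type*} [NormedAddCommGroup X] [NormedSpace ℝ X]
    [NormedAddCommGroup Y] [NormedSpace ℝ Y] (F : X → Y) (C : Set X) : Prop :=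
  ContinuousOn F C ∧ ∃ f : X → ℝ, IsControlFunctionOn f F C

/-- The modulus of convexity `δ(ε)` of the (semi)norm `p`. The infimum is taken in the extended
reals, so that it is `+∞` if there are no unit vectors. -/
noncomputable def modulusOfConvexity {Y : Type*} [AddCommGroup Y] [Module ℝ Y]
    (p : Seminorm ℝ Y) (ε : ℝ) : EReal :=
  sInf {d : EReal | ∃ x y : Y, p x = 1 ∧ p y = 1 ∧ ε ≤ p (x - y) ∧
    d = ((1 - p (x + y) / 2 : ℝ) : EReal)}

/-- The (semi)norm `p` has modulus of convexity of power type 2. -/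
def HasPowerTypeTwo {Y : Type*} [AddCommGroup Y] [Module ℝ Y] (p : Seminorm ℝ Y) : Prop :=
  ∃ a : ℝ, 0 < a ∧ ∀ ε : ℝ, 0 < ε → ε ≤ 2 → ((a * ε ^ 2 : ℝ) : EReal) ≤ modulusOfConvexity p ε

/-- `p` is a norm on `Y` equivalent to the given one (definiteness follows from the lower bound). -/
def IsEquivalentNorm {Y : Type*} [NormedAddCommGroup Y] [NormedSpace ℝ Y]
    (p : Seminorm ℝ Y) : Prop :=
  ∃ m M : ℝ, 0 < m ∧ 0 < M ∧ ∀ y : Y, m * ‖y‖ ≤ p y ∧ p y ≤ M * ‖y‖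

/-- `Y` admits a renorming with modulus of convexity of power type 2. -/
def AdmitsPowerTypeTwoRenorming (Y : Type*) [NormedAddCommGroup Y] [NormedSpace ℝ Y] : Prop :=
  ∃ p : Seminorm ℝ Y, IsEquivalentNorm p ∧ HasPowerTypeTwo p

/-- Property (D): every continuous quadratic form is a difference of two nonnegative continuous
quadratic forms. -/
def PropertyD (Y : Type*) [NormedAddCommGroup Y] [NormedSpace ℝ Y] : Prop :=
  ∀ q : QuadraticForm ℝ Y, Continuous (fun y => q y) →
    ∃ q₁ q₂ : QuadraticForm ℝ Y,
      Continuous (fun y => q₁ y) ∧ Continuous (fun y => q₂ y) ∧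
      (∀ y, 0 ≤ q₁ y) ∧ (∀ y, 0 ≤ q₂ y) ∧ ∀ y, q y = q₁ y - q₂ y

/-! The pair `(F, G)` is d.c., so it suffices to compose a d.c. mapping with the degree-two map `B`.
The key is a corrector `g`, continuous and homogeneous of degree two, making `ψ ∘ B + g` convex for
all `‖ψ‖ ≤ 1`. In case (a) a multiple of the squared renorms works, since their uniform convexity
dominates the bounded midpoint defect of `ψ ∘ B`; in case (b) one adds up the nonnegative forms into
which the coordinates of `B` split.

Subgradients of `ψ ∘ B + g` grow linearly, not boundedly, so no fixed multiple of the control `f`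
compensates them. `IsDCOn.comp_of_homogeneous` therefore adds the square of a convex function
dominating `‖F‖`: linearised at a point, it supplies a multiple of `f` as large as the subgradient
there. -/

/-- A continuous convex function on an open set has a subgradient at every point. -/
theorem ConvexOn.exists_subgradient {X : Type*} [NormedAddCommGroup X] [NormedSpace ℝ X]
    {C : Set X} {f : X → ℝ} (hf : ConvexOn ℝ C f) (hCo : IsOpen C) (hfc : ContinuousOn f C)
    {x₀ : X} (hx₀ : x₀ ∈ C) : ∃ l : X →L[ℝ] ℝ, ∀ x ∈ C, f x₀ + l (x - x₀) ≤ f x := by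
  have hopen : IsOpen {p : X × ℝ | p.1 ∈ C ∧ f p.1 < p.2} := by
    rw [isOpen_iff_mem_nhds]
    rintro ⟨x, t⟩ ⟨hx, ht⟩
    have h1 : ContinuousAt (fun p : X × ℝ => f p.1) (x, t) :=
      ContinuousAt.comp (f := Prod.fst) (hfc.continuousAt (hCo.mem_nhds hx)) continuousAt_fst
    filter_upwards [continuousAt_fst.preimage_mem_nhds (hCo.mem_nhds hx),
      h1.eventually_lt continuousAt_snd ht] with p hp1 hp2
    exact ⟨hp1, hp2⟩
  obtain ⟨L, hL⟩ := geometric_hahn_banach_open_point (x := (x₀, f x₀)) hf.convex_strict_epigraph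
    hopen (fun h => lt_irrefl _ h.2)
  have hsplit : ∀ x t, L (x, t) = L (x, 0) + t * L (0, 1) := by
    intro x t
    rw [← smul_eq_mul, ← map_smul, ← map_add]
    simp
  set a := L (0, 1) with ha
  have ha0 : a < 0 := by
    have := hL (x₀, f x₀ + 1) ⟨hx₀, by simp⟩
    rw [hsplit, hsplit x₀ (f x₀)] at this
    linarith
  refine ⟨(-a)⁻¹ • L.comp (ContinuousLinearMap.inl ℝ X ℝ), fun x hx => ?_⟩
  -- The strict epigraph omits the graph, hence the `ε` of room.
  have key : L (x, 0) + f x * a ≤ L (x₀, 0) + f x₀ * a := by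
    refine le_of_forall_pos_le_add fun ε hε => ?_
    have h1 := hL (x, f x + ε / (-a)) ⟨hx, by
      have : 0 < ε / (-a) := div_pos hε (by linarith)
      simpa using this⟩
    rw [hsplit, hsplit x₀ (f x₀)] at h1
    have h2 : ε / (-a) * a = -ε := by
      rw [div_neg, neg_mul, div_mul_cancel₀ _ ha0.ne]
    linarith [add_mul (f x) (ε / (-a)) a]
  have hsub : L (x - x₀, 0) = L (x, 0) - L (x₀, 0) := by
    rw [← map_sub]
    simp
  have h3 : (-a)⁻¹ * L (x - x₀, 0) ≤ f x - f x₀ := by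
    rw [inv_mul_le_iff₀ (by linarith), hsub]
    linarith
  simp only [smul_apply, ContinuousLinearMap.comp_apply,
    ContinuousLinearMap.inl_apply, smul_eq_mul]
  linarith

/-- A function that is touched from below by a convex function at every point is convex. -/
theorem convexOn_of_exists_convexOn_le {X : Type*} [AddCommGroup X] [Module ℝ X] {C : Set X}
    (hC : Convex ℝ C) {f : X → ℝ}
    (h : ∀ x₀ ∈ C, ∃ m : X → ℝ, ConvexOn ℝ C m ∧ f x₀ ≤ m x₀ ∧ ∀ x ∈ C, m x ≤ f x) :
    ConvexOn ℝ C f := by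
  refine ⟨hC, fun x hx y hy a b ha hb hab => ?_⟩
  obtain ⟨m, hm, h0, hle⟩ := h _ (hC hx hy ha hb hab)
  calc f (a • x + b • y) ≤ m (a • x + b • y) := h0
    _ ≤ a • m x + b • m y := hm.2 hx hy ha hb hab
    _ ≤ a • f x + b • f y := by
      simp only [smul_eq_mul]
      gcongr
      exacts [hle x hx, hle y hy]

/-- A continuous function on the line that is midpoint convex on the unit interval and vanishes
at its endpoints is nonpositive there. -/
theorem nonpos_of_midpoint_le {u : ℝ → ℝ} (hu : Continuous u) (h0 : u 0 = 0) (h1 : u 1 = 0)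
    (hmid : ∀ s t, 2 * u ((s + t) / 2) ≤ u s + u t) {t : ℝ} (ht : t ∈ Set.Icc (0 : ℝ) 1) :
    u t ≤ 0 := by
  obtain ⟨s, hs, hmax⟩ := isCompact_Icc.exists_isMaxOn
    (Set.nonempty_Icc.2 (zero_le_one' ℝ)) hu.continuousOn
  have hmax' : ∀ r, 0 ≤ r → r ≤ 1 → u r ≤ u s := fun r h h' => hmax ⟨h, h'⟩
  suffices u s ≤ 0 from (hmax' t ht.1 ht.2).trans this
  -- Reflect the nearer endpoint through the maximiser `s`; the midpoint inequality then gives `2 *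
  -- u s ≤ 0 + u s`.
  rcases le_total s (1 / 2) with h | h
  · have h2 := hmid 0 (2 * s)
    have h3 := hmax' (2 * s) (by linarith [hs.1]) (by linarith)
    rw [show (0 + 2 * s) / 2 = s by ring] at h2
    linarith
  · have h2 := hmid (2 * s - 1) 1
    have h3 := hmax' (2 * s - 1) (by linarith) (by linarith [hs.2])
    rw [show (2 * s - 1 + 1) / 2 = s by ring] at h2
    linarith

/-- A continuous midpoint convex function is convex. -/
theorem convexOn_univ_of_midpoint_le {E : Type*} [NormedAddCommGroup E] [NormedSpace ℝ E]
    {Q : E → ℝ} (hQ : Continuous Q)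
    (hmid : ∀ x y, 2 * Q ((1 / 2 : ℝ) • (x + y)) ≤ Q x + Q y) : ConvexOn ℝ Set.univ Q := by
  refine ⟨convex_univ, fun x _ y _ a b ha hb hab => ?_⟩
  have key := nonpos_of_midpoint_le (u := fun t => Q ((1 - t) • x + t • y) - ((1 - t) * Q x + t * Q y))
    (by fun_prop) (by simp) (by simp) (fun s t => by
      have h := hmid ((1 - s) • x + s • y) ((1 - t) • x + t • y)
      rw [show (1 / 2 : ℝ) • ((1 - s) • x + s • y + ((1 - t) • x + t • y)) =
        (1 - (s + t) / 2) • x + ((s + t) / 2) • y by module] at h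
      linarith) (t := b) ⟨hb, by linarith⟩
  have hab' : 1 - b = a := by linarith
  simp only [hab'] at key
  simp only [smul_eq_mul]
  linarith

/-- A continuous map homogeneous of degree two is bounded by a multiple of the squared norm. -/
theorem exists_norm_le_mul_sq {E G : Type*} [NormedAddCommGroup E] [NormedSpace ℝ E]
    [NormedAddCommGroup G] [NormedSpace ℝ G] {g : E → G} (hg : Continuous g)
    (hhom : ∀ (t : ℝ) w, g (t • w) = t ^ 2 • g w) : ∃ K, 0 ≤ K ∧ ∀ w, ‖g w‖ ≤ K * ‖w‖ ^ 2 := by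
  have h0 : g 0 = 0 := by simpa using hhom 0 0
  obtain ⟨δ, hδ, hball⟩ := Metric.continuousAt_iff.1 (hg.continuousAt (x := 0)) 1 one_pos
  simp only [dist_zero_right, h0] at hball
  refine ⟨4 / δ ^ 2, by positivity, fun w => ?_⟩
  rcases eq_or_ne w 0 with rfl | hw
  · simp [h0]
  have hw' : 0 < ‖w‖ := norm_pos_iff.2 hw
  have h1 : ‖(δ / (2 * ‖w‖)) • w‖ < δ := by
    rw [norm_smul, Real.norm_of_nonneg (by positivity)]
    field_simp
    linarith
  have h2 := hball h1
  rw [hhom, norm_smul, Real.norm_of_nonneg (by positivity)] at h2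
  have h3 : ‖g w‖ = (δ / (2 * ‖w‖)) ^ 2 * ‖g w‖ * (4 / δ ^ 2 * ‖w‖ ^ 2) := by
    field_simp
    norm_num
  rw [h3]
  exact mul_le_of_le_one_left (by positivity) h2.le

/-! ### Control functions and composition with degree-two maps -/

section Control

variable {X Y V Z : Type*} [NormedAddCommGroup X] [NormedSpace ℝ X]
  [NormedAddCommGroup Y] [NormedSpace ℝ Y] [NormedAddCommGroup V] [NormedSpace ℝ V]
  [NormedAddCommGroup Z] [NormedSpace ℝ Z] {C : Set X} {f : X → ℝ} {F : X → Y}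

theorem IsControlFunctionOn.convexOn (hf : IsControlFunctionOn f F C) : ConvexOn ℝ C f := by
  simpa using hf.2 0 (by simp)

theorem IsControlFunctionOn.convexOn_add_mul (hf : IsControlFunctionOn f F C) {c : ℝ}
    {l : Y →L[ℝ] ℝ} (hl : ‖l‖ ≤ c) : ConvexOn ℝ C (fun x => l (F x) + c * f x) := by
  rcases (norm_nonneg l).trans hl |>.eq_or_lt with rfl | hc
  · have : l = 0 := norm_le_zero_iff.1 hl
    simpa [this] using convexOn_const (0 : ℝ) hf.convexOn.1
  · have h := (hf.2 (c⁻¹ • l) (by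
      rw [norm_smul, Real.norm_of_nonneg (by positivity), inv_mul_le_iff₀ hc]
      simpa using hl)).smul hc.le
    refine h.congr fun x _ => ?_
    simp only [smul_apply, smul_eq_mul]
    field_simp

/-- The norm is a supremum of functionals of norm at most one, attained at each point. -/
theorem IsControlFunctionOn.convexOn_norm_add (hf : IsControlFunctionOn f F C) :
    ConvexOn ℝ C (fun x => ‖F x‖ + f x) := by
  refine convexOn_of_exists_convexOn_le hf.convexOn.1 fun x₀ _ => ?_
  obtain ⟨l, hl, hx₀⟩ := exists_dual_vector'' ℝ (F x₀)
  refine ⟨fun x => l (F x) + f x, hf.2 l hl, by simp [hx₀], fun x _ => ?_⟩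
  have := (le_abs_self _).trans (l.le_of_opNorm_le hl (F x))
  linarith

theorem IsControlFunctionOn.prodMk {G : X → V} {g : X → ℝ} (hf : IsControlFunctionOn f F C)
    (hg : IsControlFunctionOn g G C) :
    IsControlFunctionOn (fun x => f x + g x) (fun x => (F x, G x)) C := by
  refine ⟨hf.1.add hg.1, fun l hl => ?_⟩
  have h1 := hf.2 (l.comp (ContinuousLinearMap.inl ℝ Y V)) (by
    refine ContinuousLinearMap.opNorm_le_bound _ zero_le_one fun y => ?_
    simpa using l.le_of_opNorm_le hl (y, 0))
  have h2 := hg.2 (l.comp (ContinuousLinearMap.inr ℝ Y V)) (by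
    refine ContinuousLinearMap.opNorm_le_bound _ zero_le_one fun y => ?_
    simpa using l.le_of_opNorm_le hl (0, y))
  refine (h1.add h2).congr fun x _ => ?_
  have : l (F x, G x) = l (F x, 0) + l (0, G x) := by simp [← map_add]
  simp only [Pi.add_apply, ContinuousLinearMap.comp_apply, ContinuousLinearMap.inl_apply,
    ContinuousLinearMap.inr_apply, this]
  ring

/-- A d.c. mapping on an open convex set has a nonnegative control function. -/
theorem IsDCOn.exists_nonneg (hF : IsDCOn F C) (hCo : IsOpen C) :
    ∃ f : X → ℝ, IsControlFunctionOn f F C ∧ ∀ x ∈ C, 0 ≤ f x := by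
  obtain ⟨-, f, hf⟩ := hF
  rcases C.eq_empty_or_nonempty with rfl | ⟨x₀, hx₀⟩
  · exact ⟨f, hf, by simp⟩
  obtain ⟨l, hl⟩ := hf.convexOn.exists_subgradient hCo hf.1 hx₀
  refine ⟨fun x => f x + ((-l) x + (l x₀ - f x₀)), ⟨hf.1.add (by fun_prop), fun φ hφ => ?_⟩,
    fun x hx => ?_⟩
  · have h := (hf.2 φ hφ).add
      (((-l).toLinearMap.convexOn hf.convexOn.1).add_const (l x₀ - f x₀))
    refine h.congr fun x _ => ?_
    simp
    ring
  · have := hl x hx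
    simp only [map_sub, neg_apply] at this ⊢
    linarith

/-- A convex function of quadratic growth has subgradients of linear growth. -/
theorem ConvexOn.exists_subgradient_norm_le {Q : Y → ℝ} (hQ : ConvexOn ℝ Set.univ Q)
    (hQc : Continuous Q) {K : ℝ} (hK : 0 ≤ K) (hb : ∀ w, |Q w| ≤ K * ‖w‖ ^ 2) (w₀ : Y) :
    ∃ l : Y →L[ℝ] ℝ, ‖l‖ ≤ 5 * K * (‖w₀‖ + 1) ∧ ∀ w, Q w₀ + l (w - w₀) ≤ Q w := by
  obtain ⟨l, hl⟩ := hQ.exists_subgradient isOpen_univ hQc.continuousOn (Set.mem_univ w₀)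
  refine ⟨l, ?_, fun w => hl w trivial⟩
  have hs : 0 < ‖w₀‖ + 1 := by positivity
  -- On the ball of radius `r = ‖w₀‖ + 1` about `w₀`, `Q` is at most `4 * K * r ^ 2`, and `-Q w₀`
  -- adds at most `K * r ^ 2`.
  have key : ∀ u, ‖u‖ ≤ ‖w₀‖ + 1 → l u ≤ 5 * K * (‖w₀‖ + 1) ^ 2 := by
    intro u hu
    have h1 := hl (w₀ + u) trivial
    rw [add_sub_cancel_left] at h1
    have h2 := (le_abs_self _).trans (hb (w₀ + u))
    have h3 := (neg_abs_le _).trans' (neg_le_neg (hb w₀))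
    have h4 : ‖w₀ + u‖ ^ 2 ≤ (2 * (‖w₀‖ + 1)) ^ 2 := by
      gcongr
      linarith [norm_add_le w₀ u]
    have h5 : ‖w₀‖ ^ 2 ≤ (‖w₀‖ + 1) ^ 2 := by
      gcongr
      linarith
    nlinarith [mul_le_mul_of_nonneg_left h4 hK, mul_le_mul_of_nonneg_left h5 hK]
  have key' : ∀ u, ‖u‖ = 1 → l u ≤ 5 * K * (‖w₀‖ + 1) := by
    intro u hu
    have h := key ((‖w₀‖ + 1) • u) (by rw [norm_smul, Real.norm_of_nonneg hs.le, hu, mul_one])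
    rw [map_smul, smul_eq_mul] at h
    refine le_of_mul_le_mul_left ?_ hs
    linarith
  refine ContinuousLinearMap.opNorm_le_of_unit_norm (by positivity) fun u hu => abs_le.2 ⟨?_, key' u hu⟩
  have h := key' (-u) (by rwa [norm_neg])
  rw [map_neg] at h
  linarith

/-- If `ψ ∘ B + g` is convex for all functionals `ψ` of norm at most one, where `B` and `g` are
continuous and homogeneous of degree two, then `B ∘ F` is d.c. for every d.c. mapping `F`. -/
theorem IsDCOn.comp_of_homogeneous (hF : IsDCOn F C) (hCo : IsOpen C)
    {B : Y → Z} {g : Y → ℝ} (hB : Continuous B) (hg : Continuous g)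
    (hBhom : ∀ (t : ℝ) w, B (t • w) = t ^ 2 • B w) (hghom : ∀ (t : ℝ) w, g (t • w) = t ^ 2 • g w)
    (hconv : ∀ ψ : Z →L[ℝ] ℝ, ‖ψ‖ ≤ 1 → ConvexOn ℝ Set.univ (fun w => ψ (B w) + g w)) :
    IsDCOn (fun x => B (F x)) C := by
  obtain ⟨f, hf, hf0⟩ := hF.exists_nonneg hCo
  obtain ⟨K₁, hK₁, hB'⟩ := exists_norm_le_mul_sq hB hBhom
  obtain ⟨K₂, hK₂, hg'⟩ := exists_norm_le_mul_sq hg hghom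
  set K := 5 * (K₁ + K₂) with hKdef
  have hK : 0 ≤ K := by positivity
  have hfC := hf.convexOn
  have hs := hf.convexOn_norm_add
  -- In the square, one `f` makes `‖F‖` convex, the other absorbs `l ∘ F`, and the `1` matches the
  -- subgradient bound.
  refine ⟨hB.comp_continuousOn hF.1,
    fun x => g (F x) + K / 2 * (2 * f x + ‖F x‖ + 1) ^ 2, ?_, fun ψ hψ => ?_⟩
  · have h1 := hF.1
    have h2 := hf.1
    exact (hg.comp_continuousOn h1).add (by fun_prop)
  refine convexOn_of_exists_convexOn_le hfC.1 fun x₀ hx₀ => ?_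
  obtain ⟨l, hl, hsub⟩ := (hconv ψ hψ).exists_subgradient_norm_le (by fun_prop)
    (add_nonneg hK₁ hK₂) (fun w => by
      have h1 := (ψ.le_of_opNorm_le hψ (B w)).trans_eq (one_mul _)
      have h2 := abs_add_le (ψ (B w)) (g w)
      have h3 := hg' w
      simp only [Real.norm_eq_abs] at h1 h3
      linarith [hB' w]) (F x₀)
  rw [← hKdef] at hl
  set n₀ := ‖F x₀‖ + 1 with hn₀
  set s₀ := 2 * f x₀ + ‖F x₀‖ + 1 with hs₀
  have hs₀n : n₀ ≤ s₀ := by linarith [hf0 x₀ hx₀]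
  have hn₀0 : 0 ≤ n₀ := by positivity
  -- Minorant: the subgradient inequality plus the tangent `K * s₀ * s - K / 2 * s₀ ^ 2` of `K / 2 *
  -- s ^ 2`, grouped into convex terms. Nonnegativity of `f` gives `n₀ ≤ s₀`.
  refine ⟨fun x => (l (F x) + K * n₀ * f x) + (K * s₀) * (‖F x‖ + f x) + (K * (s₀ - n₀)) * f x
      + (K * s₀ * 1 - K / 2 * s₀ ^ 2 + ψ (B (F x₀)) + g (F x₀) - l (F x₀)), ?_, ?_, ?_⟩
  · exact (((hf.convexOn_add_mul hl).add (hs.smul (mul_nonneg hK (hn₀0.trans hs₀n)))).add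
      (hfC.smul (mul_nonneg hK (sub_nonneg.2 hs₀n)))).add_const _
  · simp only [hs₀]
    nlinarith
  · intro x _
    have h1 := hsub (F x)
    have h2 := mul_nonneg hK (sq_nonneg (2 * f x + ‖F x‖ + 1 - s₀))
    rw [map_sub] at h1
    nlinarith

end Control

/-! ### Uniform convexity of power type two -/

/-- A seminorm with modulus of convexity of power type two satisfies a quantitative parallelogram
inequality. -/
theorem HasPowerTypeTwo.exists_sq_add_sq_ge {Y : Type*} [AddCommGroup Y] [Module ℝ Y]
    {p : Seminorm ℝ Y} (hp : HasPowerTypeTwo p) :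
    ∃ c : ℝ, 0 < c ∧ ∀ x y, p (x + y) ^ 2 / 2 + c * p (x - y) ^ 2 ≤ p x ^ 2 + p y ^ 2 := by
  obtain ⟨a, ha, hmod⟩ := hp
  have hunit : ∀ u v, p u = 1 → p v = 1 → p (u + v) ≤ 2 - 2 * a * p (u - v) ^ 2 := by
    intro u v hu hv
    have h2 : p (u + v) ≤ 2 := by linarith [map_add_le_add p u v]
    rcases (apply_nonneg p (u - v)).eq_or_lt with h0 | h0
    · rw [← h0]
      linarith
    · have h3 := (hmod (p (u - v)) h0 (by linarith [map_sub_le_add p u v])).trans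
        (sInf_le ⟨u, v, hu, hv, le_rfl, rfl⟩)
      have h4 := EReal.coe_le_coe_iff.1 h3
      linarith
  have key : ∀ x y, p y ≤ p x →
      p (x + y) ^ 2 / 2 + min (1 / 4) (a / 2) * p (x - y) ^ 2 ≤ p x ^ 2 + p y ^ 2 := by
    intro x y hxy
    have hS := apply_nonneg p (x + y)
    have hD := apply_nonneg p (x - y)
    have hS2 := map_add_le_add p x y
    have hD2 := map_sub_le_add p x y
    have hc1 : min (1 / 4) (a / 2) ≤ 1 / 4 := min_le_left _ _
    have hc2 : min (1 / 4) (a / 2) ≤ a / 2 := min_le_right _ _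
    have hc0 : 0 < min (1 / 4) (a / 2) := lt_min (by norm_num) (by linarith)
    set c := min (1 / 4) (a / 2)
    rcases (apply_nonneg p y).eq_or_lt with hy | hy
    · rw [← hy, add_zero] at hS2 hD2
      rw [← hy]
      have h1 := pow_le_pow_left₀ hS hS2 2
      have h2 := pow_le_pow_left₀ hD hD2 2
      have h3 := mul_le_mul hc1 h2 (sq_nonneg _) (by norm_num)
      linarith [sq_nonneg (p x)]
    · have hx : 0 < p x := hy.trans_le hxy
      set α := p x with hα
      set β := p y with hβ
      set u := α⁻¹ • x with hu
      set v := β⁻¹ • y with hv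
      have hxu : x = α • u := by rw [hu, smul_inv_smul₀ hx.ne']
      have hyv : y = β • v := by rw [hv, smul_inv_smul₀ hy.ne']
      have hpu : p u = 1 := by
        rw [hu, map_smul_eq_mul, Real.norm_of_nonneg (by positivity), ← hα, inv_mul_cancel₀ hx.ne']
      have hpv : p v = 1 := by
        rw [hv, map_smul_eq_mul, Real.norm_of_nonneg (by positivity), ← hβ, inv_mul_cancel₀ hy.ne']
      have huv := hunit u v hpu hpv
      have he := apply_nonneg p (u - v)
      set e := p (u - v)
      have hαβ : 0 ≤ α - β := by linarith
      -- Cut the longer vector down to length `β`: the modulus handles the equal-length part, the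
      -- triangle inequality the excess `(α - β) • u`.
      have hSle : p (x + y) ≤ α + β - 2 * a * β * e ^ 2 := by
        have h1 : x + y = β • (u + v) + (α - β) • u := by
          rw [hxu, hyv]
          module
        have h2 := map_add_le_add p (β • (u + v)) ((α - β) • u)
        rw [← h1, map_smul_eq_mul, map_smul_eq_mul, Real.norm_of_nonneg hy.le,
          Real.norm_of_nonneg hαβ, hpu] at h2
        nlinarith [mul_le_mul_of_nonneg_left huv hy.le]
      have hDle : p (x - y) ≤ β * e + (α - β) := by
        have h1 : x - y = β • (u - v) + (α - β) • u := by
          rw [hxu, hyv]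
          module
        have h2 := map_add_le_add p (β • (u - v)) ((α - β) • u)
        rw [← h1, map_smul_eq_mul, map_smul_eq_mul, Real.norm_of_nonneg hy.le,
          Real.norm_of_nonneg hαβ, hpu] at h2
        linarith
      have hSsq : p (x + y) ^ 2 ≤ (α + β) * (α + β - 2 * a * β * e ^ 2) := by
        rw [sq]
        exact mul_le_mul hS2 hSle hS (by linarith)
      have hDsq : p (x - y) ^ 2 ≤ 2 * (β * e) ^ 2 + 2 * (α - β) ^ 2 :=
        (pow_le_pow_left₀ hD hDle 2).trans (by nlinarith [sq_nonneg (β * e - (α - β))])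
      have h1 := mul_le_mul_of_nonneg_left hDsq hc0.le
      have h2 := mul_le_mul_of_nonneg_right hc1 (sq_nonneg (α - β))
      have h3 := mul_le_mul_of_nonneg_right hc2 (sq_nonneg (β * e))
      have h4 : 0 ≤ a * β * e ^ 2 * α := by positivity
      -- `c ≤ 1 / 4` lets `(α - β) ^ 2 / 2` pay for the length difference; `c ≤ a / 2` lets `a * (β
      -- * e) ^ 2` pay for the angular part.
      nlinarith
  refine ⟨min (1 / 4) (a / 2), lt_min (by norm_num) (by linarith), fun x y => ?_⟩
  rcases le_total (p y) (p x) with h | h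
  · exact key x y h
  · have := key y x h
    rwa [add_comm y x, map_sub_rev p y x, add_comm (p y ^ 2)] at this

theorem IsEquivalentNorm.continuous {Y : Type*} [NormedAddCommGroup Y] [NormedSpace ℝ Y]
    {p : Seminorm ℝ Y} (hp : IsEquivalentNorm p) : Continuous p := by
  obtain ⟨m, M, -, hM, h⟩ := hp
  refine Seminorm.continuous_of_le (q := M.toNNReal • normSeminorm ℝ Y) ?_ fun y => ?_
  · exact continuous_const.mul continuous_norm
  · simpa [NNReal.smul_def, hM.le] using (h y).2

/-- The square of an equivalent norm of power type two is uniformly convex with respect to the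
original norm. -/
theorem AdmitsPowerTypeTwoRenorming.exists_sq_add_sq_ge {Y : Type*} [NormedAddCommGroup Y]
    [NormedSpace ℝ Y] (hY : AdmitsPowerTypeTwoRenorming Y) :
    ∃ (p : Seminorm ℝ Y) (c : ℝ), Continuous p ∧ 0 < c ∧
      ∀ x y, p (x + y) ^ 2 / 2 + c * ‖x - y‖ ^ 2 ≤ p x ^ 2 + p y ^ 2 := by
  obtain ⟨p, hp, hp2⟩ := hY
  obtain ⟨c, hc, h⟩ := hp2.exists_sq_add_sq_ge
  have hpc := hp.continuous
  obtain ⟨m, M, hm, -, hle⟩ := hp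
  refine ⟨p, c * m ^ 2, hpc, by positivity, fun x y => (h x y).trans' ?_⟩
  have := pow_le_pow_left₀ (by positivity) (hle (x - y)).1 2
  nlinarith [mul_le_mul_of_nonneg_left this hc.le]

/-- A nonnegative continuous quadratic form is convex. -/
theorem QuadraticForm.convexOn_of_nonneg {E : Type*} [NormedAddCommGroup E] [NormedSpace ℝ E]
    (q : QuadraticForm ℝ E) (hq : Continuous (fun w => q w)) (h0 : ∀ w, 0 ≤ q w) :
    ConvexOn ℝ Set.univ (fun w => q w) := by
  refine convexOn_univ_of_midpoint_le hq fun x y => ?_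
  have h2 : q (x - y) = q x + q y - QuadraticMap.polar q x y := by
    have := QuadraticMap.map_add q x (-y)
    rw [QuadraticMap.polar_neg_right, QuadraticMap.map_neg, ← sub_eq_add_neg] at this
    linarith
  have h3 := QuadraticMap.map_add q x y
  have h4 := h0 (x - y)
  rw [QuadraticMap.map_smul, smul_eq_mul]
  linarith

/-! ### Convex correctors for bilinear maps -/

section Bilinear

variable {Y V Z : Type*} [NormedAddCommGroup Y] [NormedSpace ℝ Y] [NormedAddCommGroup V]
  [NormedSpace ℝ V] [NormedAddCommGroup Z] [NormedSpace ℝ Z]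

theorem bilinear_homogeneous (B : Y →ₗ[ℝ] V →ₗ[ℝ] Z) (t : ℝ) (w : Y × V) :
    B (t • w).1 (t • w).2 = t ^ 2 • B w.1 w.2 := by
  simp [smul_smul, sq]

theorem exists_convex_corrector_of_renorming (hY : AdmitsPowerTypeTwoRenorming Y)
    (hV : AdmitsPowerTypeTwoRenorming V) (B : Y →ₗ[ℝ] V →ₗ[ℝ] Z)
    (hB : Continuous (fun w : Y × V => B w.1 w.2)) :
    ∃ g : Y × V → ℝ, Continuous g ∧ (∀ (t : ℝ) w, g (t • w) = t ^ 2 • g w) ∧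
      ∀ ψ : Z →L[ℝ] ℝ, ‖ψ‖ ≤ 1 → ConvexOn ℝ Set.univ (fun w => ψ (B w.1 w.2) + g w) := by
  obtain ⟨p, c, hp, hc, hpc⟩ := hY.exists_sq_add_sq_ge
  obtain ⟨r, d, hr, hd, hrd⟩ := hV.exists_sq_add_sq_ge
  obtain ⟨K, hK, hBK⟩ := exists_norm_le_mul_sq hB (bilinear_homogeneous B)
  refine ⟨fun w => K / c * p w.1 ^ 2 + K / d * r w.2 ^ 2, by fun_prop, fun t w => ?_,
    fun ψ hψ => convexOn_univ_of_midpoint_le (by fun_prop) fun x y => ?_⟩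
  · simp only [Prod.smul_fst, Prod.smul_snd, map_smul_eq_mul, mul_pow, Real.norm_eq_abs, sq_abs,
      smul_eq_mul]
    ring
  -- For a quadratic form the midpoint defect depends only on `x - y`, so it is at most a multiple
  -- of `‖x - y‖ ^ 2`.
  · have h1 : 4 * ψ (B ((1 / 2 : ℝ) • (x + y)).1 ((1 / 2 : ℝ) • (x + y)).2) =
        2 * (ψ (B x.1 x.2) + ψ (B y.1 y.2)) - ψ (B (x - y).1 (x - y).2) := by
      simp only [Prod.smul_fst, Prod.smul_snd, Prod.fst_add, Prod.snd_add, Prod.fst_sub,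
        Prod.snd_sub, map_smul, map_add, map_sub, LinearMap.smul_apply, LinearMap.add_apply,
        LinearMap.sub_apply, smul_eq_mul]
      ring
    have h2 : -ψ (B (x - y).1 (x - y).2) ≤ K * ‖x - y‖ ^ 2 :=
      (neg_le_abs _).trans <| ((ψ.le_of_opNorm_le hψ _).trans_eq (one_mul _)).trans (hBK (x - y))
    have h3 : ‖x - y‖ ^ 2 ≤ ‖x.1 - y.1‖ ^ 2 + ‖x.2 - y.2‖ ^ 2 := by
      rw [Prod.norm_def]
      rcases max_cases ‖(x - y).1‖ ‖(x - y).2‖ with h | h <;> rw [h.1]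
      · simp
      · simp
    have h4 := mul_le_mul_of_nonneg_left (hpc x.1 y.1) (div_nonneg hK hc.le)
    have h5 := mul_le_mul_of_nonneg_left (hrd x.2 y.2) (div_nonneg hK hd.le)
    have h6 : K / c * (c * ‖x.1 - y.1‖ ^ 2) = K * ‖x.1 - y.1‖ ^ 2 := by field_simp
    have h7 : K / d * (d * ‖x.2 - y.2‖ ^ 2) = K * ‖x.2 - y.2‖ ^ 2 := by field_simp
    have h8 := mul_le_mul_of_nonneg_left h3 hK
    rw [mul_add, h6] at h4
    rw [mul_add, h7] at h5
    have h9 : p ((1 / 2 : ℝ) • (x + y)).1 ^ 2 = p (x.1 + y.1) ^ 2 / 4 := by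
      rw [Prod.smul_fst, map_smul_eq_mul, mul_pow, Real.norm_eq_abs, sq_abs, Prod.fst_add]
      ring
    have h10 : r ((1 / 2 : ℝ) • (x + y)).2 ^ 2 = r (x.2 + y.2) ^ 2 / 4 := by
      rw [Prod.smul_snd, map_smul_eq_mul, mul_pow, Real.norm_eq_abs, sq_abs, Prod.snd_add]
      ring
    beta_reduce
    rw [h9, h10]
    have h11 : 0 ≤ K * (‖x.1 - y.1‖ ^ 2 + ‖x.2 - y.2‖ ^ 2) := by positivity
    linarith

/-- Since `|ψ (b i)| ≤ ‖b i‖`, the weights `‖b i‖` make every coefficient of `q₁ i` and `q₂ i` in `ψ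
∘ B + g` nonnegative, uniformly in `ψ`; a nonnegative continuous quadratic form is convex. -/
theorem exists_convex_corrector_of_propertyD [FiniteDimensional ℝ Z] (hD : PropertyD (Y × V))
    (B : Y →ₗ[ℝ] V →ₗ[ℝ] Z) (hB : Continuous (fun w : Y × V => B w.1 w.2)) :
    ∃ g : Y × V → ℝ, Continuous g ∧ (∀ (t : ℝ) w, g (t • w) = t ^ 2 • g w) ∧
      ∀ ψ : Z →L[ℝ] ℝ, ‖ψ‖ ≤ 1 → ConvexOn ℝ Set.univ (fun w => ψ (B w.1 w.2) + g w) := by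
  let b := Module.finBasis ℝ Z
  have hdec : ∀ i, ∃ q₁ q₂ : QuadraticForm ℝ (Y × V),
      Continuous (fun w => q₁ w) ∧ Continuous (fun w => q₂ w) ∧
      (∀ w, 0 ≤ q₁ w) ∧ (∀ w, 0 ≤ q₂ w) ∧ ∀ w, b.coord i (B w.1 w.2) = q₁ w - q₂ w := fun i =>
    hD (LinearMap.BilinMap.toQuadraticMap
      ((B.compl₁₂ (LinearMap.fst ℝ Y V) (LinearMap.snd ℝ Y V)).compr₂ (b.coord i))) <|
      (LinearMap.continuous_of_finiteDimensional (b.coord i)).comp hB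
  choose q₁ q₂ hc₁ hc₂ h₁ h₂ heq using hdec
  refine ⟨fun w => ∑ i, ‖b i‖ * (q₁ i w + q₂ i w), ?_, fun t w => ?_, fun ψ hψ => ?_⟩
  · exact continuous_finsetSum _ fun i _ => continuous_const.mul ((hc₁ i).add (hc₂ i))
  · simp only [QuadraticMap.map_smul, smul_eq_mul, Finset.mul_sum]
    exact Finset.sum_congr rfl fun i _ => by ring
  · have habs : ∀ i, |ψ (b i)| ≤ ‖b i‖ := fun i =>
      (ψ.le_of_opNorm_le hψ (b i)).trans_eq (one_mul _)
    let q : QuadraticForm ℝ (Y × V) :=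
      ∑ i, ((‖b i‖ + ψ (b i)) • q₁ i + (‖b i‖ - ψ (b i)) • q₂ i)
    have hq : ∀ w, q w = ∑ i, ((‖b i‖ + ψ (b i)) * q₁ i w + (‖b i‖ - ψ (b i)) * q₂ i w) :=
      fun w => by simp [q]
    have hconv := QuadraticForm.convexOn_of_nonneg q
      (by
        simp only [hq]
        exact continuous_finsetSum _ fun i _ =>
          (continuous_const.mul (hc₁ i)).add (continuous_const.mul (hc₂ i)))
      (fun w => by
        rw [hq]
        exact Finset.sum_nonneg fun i _ => add_nonneg
          (mul_nonneg (by linarith [(abs_le.1 (habs i)).1]) (h₁ i w))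
          (mul_nonneg (by linarith [(abs_le.1 (habs i)).2]) (h₂ i w)))
    refine hconv.congr fun w _ => ?_
    have hsum : ψ (B w.1 w.2) = ∑ i, (q₁ i w - q₂ i w) * ψ (b i) := by
      conv_lhs => rw [← b.sum_repr (B w.1 w.2)]
      simp only [map_sum, map_smul, smul_eq_mul, ← heq, Module.Basis.coord_apply]
    simp only [hq, hsum, ← Finset.sum_add_distrib]
    exact Finset.sum_congr rfl fun i _ => by ring

end Bilinear

theorem corollary2p8 {X Y V Z : Type*}
    [NormedAddCommGroup X] [NormedSpace ℝ X] [NormedAddCommGroup Y] [NormedSpace ℝ Y]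
    [NormedAddCommGroup V] [NormedSpace ℝ V] [NormedAddCommGroup Z] [NormedSpace ℝ Z]
    (C : Set X) (hCo : IsOpen C) (hCc : Convex ℝ C)
    (F : X → Y) (hF : IsDCOn F C) (G : X → V) (hG : IsDCOn G C)
    (B : Y →ₗ[ℝ] V →ₗ[ℝ] Z) (hB : Continuous (fun w : Y × V => B w.1 w.2))
    (h : (AdmitsPowerTypeTwoRenorming Y ∧ AdmitsPowerTypeTwoRenorming V) ∨
      (FiniteDimensional ℝ Z ∧ PropertyD (Y × V))) :
    IsDCOn (fun x => B (F x) (G x)) C := by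
  have hFG : IsDCOn (fun x => (F x, G x)) C := by
    obtain ⟨hFc, f, hf⟩ := hF
    obtain ⟨hGc, g, hg⟩ := hG
    exact ⟨hFc.prodMk hGc, _, hf.prodMk hg⟩
  obtain ⟨g, hg, hghom, hconv⟩ : ∃ g : Y × V → ℝ, Continuous g ∧
      (∀ (t : ℝ) w, g (t • w) = t ^ 2 • g w) ∧
      ∀ ψ : Z →L[ℝ] ℝ, ‖ψ‖ ≤ 1 → ConvexOn ℝ Set.univ (fun w => ψ (B w.1 w.2) + g w) := by
    rcases h with ⟨hY, hV⟩ | ⟨hZ, hD⟩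
    · exact exists_convex_corrector_of_renorming hY hV B hB
    · exact exists_convex_corrector_of_propertyD hD B hB
  exact hFG.comp_of_homogeneous hCo hB hg (bilinear_homogeneous B) hghom hconv
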